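/- Let $d$ be the (finite) dimension of the Hilbert space and let $M_d(\mathbb{C})$ be the space of complex $d\times d$ matrices. Let $\mathbb{U}$ be the set of unitary maps, i.e. of the linear maps $X \mapsto u X u^\dagger$ on $M_d(\mathbb{C})$ with $u$ a unitary $d\times d$ matrix. Let $\mathcal{W}(X) = X^{\mathrm T}$ be the transpose map on $M_d(\mathbb{C})$, let $\mathbb{A} = \{\mathcal{W}\,\mathcal{U} : \mathcal{U}\in\mathbb{U}\}$ be the set of antiunitary transformations (these are the linear maps on $M_d(\mathbb{C})$ for which there is an antiunitary operator $v$ on $\mathbb{C}^d$ such that every rank-one projection $|\psi\rangle\langle\psi|$ is sent to $|v\psi\rangle\langle v\psi|$), and let $\mathbb{S} = \mathbb{U}\cup\mathbb{A}$ be the set of unitary and antiunitary transformations. Let $\mathcal{T}$ be an invertible complex-linear map on $M_d(\mathbb{C})$. Then $\mathcal{T}^{-1}\,\mathcal{U}\,\mathcal{T} \in \mathbb{U}$ for all $\mathcal{U}\in\mathbb{U}$ if and only if there exists a single $\mathcal{S}\in\mathbb{S}$ such that $\mathcal{S}^{-1}\,\mathcal{U}\,\mathcal{S} = \mathcal{T}^{-1}\,\mathcal{U}\,\mathcal{T}$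 for all $\mathcal{U}\in\mathbb{U}$. -/

import Mathlib

namespace MatrixMap

/-- The group of invertible `ℂ`-linear maps on the space of `d × d` complex matrices.
Multiplication is composition, `(F * G) X = F (G X)`, and `F⁻¹` is the inverse map. -/
abbrev InvMap (d : ℕ) : Type :=
  Matrix (Fin d) (Fin d) ℂ ≃ₗ[ℂ] Matrix (Fin d) (Fin d) ℂ

/-- The map `X ↦ u X u†` of a unitary matrix `u`; its inverse is `X ↦ u† X u`. -/
def ofUnitary {d : ℕ} (u : Matrix.unitaryGroup (Fin d) ℂ) : InvMap d where
  toFun X := (u : Matrix (Fin d) (Fin d) ℂ) * X * (u : Matrix (Fin d) (Fin d) ℂ).conjTranspose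
  map_add' X Y := by rw [mul_add, add_mul]
  map_smul' c X := by simp
  invFun X := (u : Matrix (Fin d) (Fin d) ℂ).conjTranspose * X * (u : Matrix (Fin d) (Fin d) ℂ)
  left_inv X := by
    have h : (u : Matrix (Fin d) (Fin d) ℂ).conjTranspose * (u : Matrix (Fin d) (Fin d) ℂ) = 1 :=
      Matrix.UnitaryGroup.star_mul_self u
    simp only [Matrix.mul_assoc, h, Matrix.mul_one]
    rw [← Matrix.mul_assoc, h, Matrix.one_mul]
  right_inv X := by
    have h : (u : Matrix (Fin d) (Fin d) ℂ) * (u : Matrix (Fin d) (Fin d) ℂ).conjTranspose = 1 :=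
      Unitary.coe_mul_star_self u
    simp only [Matrix.mul_assoc, h, Matrix.mul_one]
    rw [← Matrix.mul_assoc, h, Matrix.one_mul]

/-- The set of unitary maps (unitary channels) `X ↦ u X u†`, `u` a unitary `d × d` matrix. -/
def unitaryMaps (d : ℕ) : Set (InvMap d) :=
  {F | ∃ u : Matrix.unitaryGroup (Fin d) ℂ, F = ofUnitary u}

/-- The transpose map `X ↦ Xᵀ` with respect to the standard basis. -/
def transposeMap (d : ℕ) : InvMap d :=
  Matrix.transposeLinearEquiv (Fin d) (Fin d) ℂ ℂ

/-- The antiunitary transformations on matrices, `X ↦ (u X u†)ᵀ` with `u` unitary. They are the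
linear maps that send `|ψ⟩⟨ψ|` to `|vψ⟩⟨vψ|`, `v` being an antiunitary operator on the Hilbert
space `ℂᵈ`, that is, a unitary matrix followed by complex conjugation. -/
def antiunitaryMaps (d : ℕ) : Set (InvMap d) :=
  {F | ∃ U ∈ unitaryMaps d, F = transposeMap d * U}

/-- The unitary and antiunitary transformations on matrices. -/
def symmetryMaps (d : ℕ) : Set (InvMap d) :=
  unitaryMaps d ∪ antiunitaryMaps d

end MatrixMap

/-! The converse only needs that symmetries normalise the unitary maps. For the forward direction
let φ(E) = T E T⁻¹, an algebra automorphism of End(M_d); every unitary map is φ of a unitary map.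
For P = |v⟩⟨v| with v a unit vector, conjugation by 1 + (i-1)P = exp(iπP/2) is killed by
(x-1)(x²+1). Its unitary preimage satisfies the same relation, hence comes up to phase from 1 +
(i-1)Q with Q a projection (`exists_isStarProjection_of_conjEnd_polynomial`), and so ad P = φ(ad Q).

Since φ preserves traces, the form tr(ad A ad B) gives tr Q = 1 or d-1. Replacing Q by 1-Q in the
second case costs a sign s, which is the same for all v (`exists_sign_adOuterEq`). Then ad X = s
φ(ad (θ X)), with tr θ(X) = tr X, defines a linear bijection θ that respects adjoints, squares and,
up to s, commutators. It is therefore a *-automorphism (s = 1) or a *-antiautomorphism (s = -1), and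
lies in `symmetryMaps`. It intertwines each unitary map U with T⁻¹ U T, so S = θ⁻¹ works. -/

namespace MatrixMap

open Matrix Complex
open scoped ComplexOrder

variable {d : ℕ}

/-! ### Rank-one projections and the spectral theorem -/

/-- The rank-one matrix `|v⟩⟨v|`. -/
def outer (v : Fin d → ℂ) : Matrix (Fin d) (Fin d) ℂ := vecMulVec v (star v)

lemma outer_mul_outer (v w : Fin d → ℂ) :
    outer v * outer w = (star v ⬝ᵥ w) • vecMulVec v (star w) := by
  simp [outer, vecMulVec_mul_vecMulVec, vecMulVec_smul]

lemma isStarProjection_outer {v : Fin d → ℂ} (hv : star v ⬝ᵥ v = 1) :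
    IsStarProjection (outer v) := by
  refine ⟨?_, ?_⟩
  · rw [IsIdempotentElem, outer_mul_outer, hv, one_smul, outer]
  · ext i j
    simp [outer, vecMulVec_apply, mul_comm]

lemma trace_outer {v : Fin d → ℂ} (hv : star v ⬝ᵥ v = 1) : (outer v).trace = 1 := by
  rw [outer, trace_vecMulVec, dotProduct_comm, hv]

lemma outer_mul_outer_eq_zero {v w : Fin d → ℂ} (h : star v ⬝ᵥ w = 0) :
    outer v * outer w = 0 := by
  rw [outer_mul_outer, h, zero_smul]

/-- Links any two vectors through a common orthogonal one, so that a sign can be carried from one to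
the other. -/
lemma exists_orthogonal_pair (hd : 3 ≤ d) (a b : Fin d → ℂ) :
    ∃ v : Fin d → ℂ, star v ⬝ᵥ v = 1 ∧ star a ⬝ᵥ v = 0 ∧ star b ⬝ᵥ v = 0 := by
  obtain ⟨x, hx, hx0⟩ := Submodule.exists_mem_ne_zero_of_ne_bot
    (LinearMap.ker_ne_bot_of_finrank_lt (f := (Matrix.of ![star a, star b]).mulVecLin)
      (by simp; omega))
  have ha : star a ⬝ᵥ x = 0 := congrFun (LinearMap.mem_ker.1 hx) 0
  have hb : star b ⬝ᵥ x = 0 := congrFun (LinearMap.mem_ker.1 hx) 1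
  set r : ℝ := ∑ i, ‖x i‖ ^ 2 with hr
  have hxr : star x ⬝ᵥ x = (r : ℂ) := by
    simp [dotProduct, hr, Complex.conj_mul']
  have hr0 : 0 < r := by
    obtain ⟨i, hi⟩ := Function.ne_iff.1 hx0
    exact Finset.sum_pos' (fun _ _ => by positivity)
      ⟨i, Finset.mem_univ _, by have : x i ≠ 0 := hi; positivity⟩
  refine ⟨((Real.sqrt r)⁻¹ : ℂ) • x, ?_, by simp [ha], by simp [hb]⟩
  have h1 : ((Real.sqrt r : ℝ) : ℂ) * (Real.sqrt r : ℝ) = r := by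
    rw [← ofReal_mul, Real.mul_self_sqrt hr0.le]
  have h2 : ((Real.sqrt r : ℝ) : ℂ) ≠ 0 := by
    exact_mod_cast (Real.sqrt_pos.2 hr0).ne'
  simp only [star_smul, smul_dotProduct, dotProduct_smul, hxr, smul_eq_mul]
  rw [← h1]
  simp
  field_simp

lemma _root_.Matrix.IsHermitian.exists_eq_sum_smul_outer {H : Matrix (Fin d) (Fin d) ℂ}
    (hH : H.IsHermitian) : ∃ (c : Fin d → ℝ) (v : Fin d → Fin d → ℂ),
      (∀ i j, star (v i) ⬝ᵥ v j = if i = j then 1 else 0) ∧ H = ∑ i, (c i : ℂ) • outer (v i) := by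
  refine ⟨hH.eigenvalues, fun i => ⇑(hH.eigenvectorBasis i), fun i j => ?_, ?_⟩
  · rw [dotProduct_comm, ← EuclideanSpace.inner_eq_star_dotProduct]
    exact orthonormal_iff_ite.1 hH.eigenvectorBasis.orthonormal i j
  · conv_lhs => rw [hH.spectral_theorem]
    ext i j
    simp [Unitary.conjStarAlgAut_apply, mul_apply, outer, vecMulVec_apply, diagonal_apply,
      Matrix.sum_apply, star_apply]
    refine Finset.sum_congr rfl fun k _ => by ring

lemma span_outer_eq_top :
    Submodule.span ℂ (outer '' {v : Fin d → ℂ | star v ⬝ᵥ v = 1}) = ⊤ := by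
  have key : ∀ H : Matrix (Fin d) (Fin d) ℂ, H.IsHermitian →
      H ∈ Submodule.span ℂ (outer '' {v : Fin d → ℂ | star v ⬝ᵥ v = 1}) := by
    intro H hH
    obtain ⟨c, v, hv, rfl⟩ := hH.exists_eq_sum_smul_outer
    exact Submodule.sum_mem _ fun i _ => Submodule.smul_mem _ _
      (Submodule.subset_span ⟨v i, by simpa using hv i i, rfl⟩)
  refine eq_top_iff.2 fun X _ => ?_
  rw [← realPart_add_I_smul_imaginaryPart X]
  exact Submodule.add_mem _ (key _ (realPart X).2)
    (Submodule.smul_mem _ _ (key _ (imaginaryPart X).2))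

/-! ### Commutator maps, their trace form, and traces of projections -/

lemma trace_mulLeft_comp_mulRight (A B : Matrix (Fin d) (Fin d) ℂ) :
    LinearMap.trace ℂ _ (LinearMap.mulLeft ℂ A ∘ₗ LinearMap.mulRight ℂ B) =
      A.trace * B.trace := by
  rw [LinearMap.trace_eq_matrix_trace ℂ (Matrix.stdBasis ℂ (Fin d) (Fin d)), Matrix.trace,
    Fintype.sum_prod_type, Matrix.trace, Matrix.trace, Finset.sum_mul_sum]
  refine Finset.sum_congr rfl fun i _ => Finset.sum_congr rfl fun j _ => ?_
  rw [Matrix.diag_apply, LinearMap.toMatrix_apply, Matrix.stdBasis_eq_single]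
  simp [Matrix.stdBasis, ← Matrix.mul_assoc, Matrix.mul_apply, Matrix.single_apply, ite_and]

/-- The commutator map `X ↦ A X - X A`. -/
def ad : Matrix (Fin d) (Fin d) ℂ →ₗ[ℂ] Module.End ℂ (Matrix (Fin d) (Fin d) ℂ) :=
  LinearMap.mul ℂ _ - (LinearMap.mul ℂ _).flip

lemma ad_apply (A X : Matrix (Fin d) (Fin d) ℂ) : ad A X = A * X - X * A := rfl

lemma ad_commutator (A B : Matrix (Fin d) (Fin d) ℂ) :
    ad (A * B - B * A) = ad A * ad B - ad B * ad A := by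
  ext1 X
  simp only [ad_apply, LinearMap.sub_apply, Module.End.mul_apply]
  noncomm_ring

lemma ad_one : ad (1 : Matrix (Fin d) (Fin d) ℂ) = 0 := by
  ext1 X
  simp [ad_apply]

/-- The trace form of the adjoint representation of the Lie algebra of all matrices. -/
lemma trace_ad_mul_ad (A B : Matrix (Fin d) (Fin d) ℂ) :
    LinearMap.trace ℂ _ (ad A * ad B) =
      2 * d * (A * B).trace - 2 * A.trace * B.trace := by
  have h : (ad A * ad B : Module.End ℂ (Matrix (Fin d) (Fin d) ℂ)) =
      LinearMap.mulLeft ℂ (A * B) ∘ₗ LinearMap.mulRight ℂ 1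
      - LinearMap.mulLeft ℂ A ∘ₗ LinearMap.mulRight ℂ B
      - LinearMap.mulLeft ℂ B ∘ₗ LinearMap.mulRight ℂ A
      + LinearMap.mulLeft ℂ 1 ∘ₗ LinearMap.mulRight ℂ (B * A) := by
    ext1 X
    simp [ad_apply]
    noncomm_ring
  rw [h]
  simp only [map_sub, map_add, trace_mulLeft_comp_mulRight, trace_one, Fintype.card_fin,
    trace_mul_comm B A]
  ring

lemma eq_zero_of_ad_eq_zero {A : Matrix (Fin d) (Fin d) ℂ} (h : ad A = 0)
    (ht : A.trace = 0) : A = 0 := by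
  obtain ⟨c, rfl⟩ := mem_range_scalar_of_commute_single (M := A) fun i j _ => by
    have := LinearMap.congr_fun h (single i j 1)
    simp [ad_apply, sub_eq_zero] at this
    exact this.symm
  rcases Nat.eq_zero_or_pos d with rfl | hd
  · exact Subsingleton.elim _ _
  · have : (d : ℂ) ≠ 0 := by exact_mod_cast hd.ne'
    simp [this] at ht
    simp [ht]

/-- The kernel of `ad` is the scalars, and the trace separates those when d > 0. -/
lemma ext_of_ad_eq {A B : Matrix (Fin d) (Fin d) ℂ}
    (h : ad A = ad B)
    (ht : A.trace = B.trace) : A = B :=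
  sub_eq_zero.1 <| eq_zero_of_ad_eq_zero (by rw [map_sub, h, sub_self])
    (by rw [trace_sub, ht, sub_self])

lemma exists_trace_eq_natCast {E : Matrix (Fin d) (Fin d) ℂ} (hE : IsIdempotentElem E) :
    ∃ n : ℕ, E.trace = n := by
  have h : IsIdempotentElem (Matrix.toLin' E) := by
    rw [IsIdempotentElem, Module.End.mul_eq_comp, ← Matrix.toLin'_mul, hE.eq]
  exact ⟨_, by rw [← Matrix.trace_toLin'_eq]; exact (LinearMap.IsIdempotentElem.isProj_range _ h).trace⟩

/-- For projections, tr(QR) is the squared Hilbert–Schmidt norm of QR. -/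
lemma mul_eq_zero_of_trace_mul_eq_zero {Q R : Matrix (Fin d) (Fin d) ℂ}
    (hQ : IsStarProjection Q) (hR : IsStarProjection R) (h : (Q * R).trace = 0) : Q * R = 0 := by
  rw [← trace_mul_conjTranspose_self_eq_zero_iff, conjTranspose_mul]
  have h1 : Qᴴ = Q := hQ.isSelfAdjoint
  have h2 : Rᴴ = R := hR.isSelfAdjoint
  rw [h1, h2, Matrix.mul_assoc, ← Matrix.mul_assoc R R, hR.isIdempotentElem.eq, trace_mul_comm,
    Matrix.mul_assoc, hQ.isIdempotentElem.eq, trace_mul_comm, h]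

/-! ### Recognising the unitaries 1 + (i-1)P from their conjugations -/

/-- Conjugation by a unitary matrix, as an element of the endomorphism algebra. -/
def conjEnd (u : unitaryGroup (Fin d) ℂ) : Module.End ℂ (Matrix (Fin d) (Fin d) ℂ) :=
  (ofUnitary u).toLinearMap

lemma conjEnd_apply (u : unitaryGroup (Fin d) ℂ) (X : Matrix (Fin d) (Fin d) ℂ) :
    conjEnd u X = (u : Matrix (Fin d) (Fin d) ℂ) * X * (u : Matrix (Fin d) (Fin d) ℂ)ᴴ := rfl

lemma conjEnd_mul (u w : unitaryGroup (Fin d) ℂ) : conjEnd (u * w) = conjEnd u * conjEnd w := by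
  ext1 X
  simp [conjEnd_apply, Matrix.mul_assoc]

lemma conjEnd_one : conjEnd (1 : unitaryGroup (Fin d) ℂ) = 1 := by
  ext1 X
  simp [conjEnd_apply]

lemma conjEnd_pow (u : unitaryGroup (Fin d) ℂ) (k : ℕ) : conjEnd u ^ k = conjEnd (u ^ k) := by
  induction k with
  | zero => rw [pow_zero, pow_zero, conjEnd_one]
  | succ k ih => rw [pow_succ, pow_succ, conjEnd_mul, ih]

lemma exists_unitary_eq_smul (w : unitaryGroup (Fin d) ℂ) {c : ℂ} (hc : star c * c = 1) :
    ∃ u : unitaryGroup (Fin d) ℂ, (u : Matrix (Fin d) (Fin d) ℂ) = c • (w : Matrix _ _ ℂ) ∧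
      conjEnd u = conjEnd w := by
  have hc' : c * star c = 1 := by rw [mul_comm, hc]
  have h : (w : Matrix (Fin d) (Fin d) ℂ) * (w : Matrix (Fin d) (Fin d) ℂ)ᴴ = 1 :=
    Unitary.coe_mul_star_self w
  refine ⟨⟨c • (w : Matrix _ _ ℂ), ?_⟩, rfl, ?_⟩
  · rw [mem_unitaryGroup_iff, star_eq_conjTranspose, conjTranspose_smul, smul_mul_smul_comm, h,
      hc', one_smul]
  · ext1 X
    simp only [conjEnd_apply, conjTranspose_smul, smul_mul_assoc, mul_smul_comm, smul_smul, hc,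
      one_smul]

lemma exists_unitary_eq_one_add {P : Matrix (Fin d) (Fin d) ℂ} (hP : IsStarProjection P) :
    ∃ u : unitaryGroup (Fin d) ℂ, (u : Matrix (Fin d) (Fin d) ℂ) = 1 + (I - 1) • P := by
  have h1 : Pᴴ = P := hP.isSelfAdjoint
  have h2 : P * P = P := hP.isIdempotentElem
  refine ⟨⟨1 + (I - 1) • P, ?_⟩, rfl⟩
  rw [mem_unitaryGroup_iff, star_eq_conjTranspose]
  simp only [conjTranspose_add, conjTranspose_one, conjTranspose_smul, h1, add_mul, mul_add,
    one_mul, mul_one, smul_mul_smul_comm, h2]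
  have : star (I - 1) + (I - 1 + (I - 1) * star (I - 1)) = 0 := by
    simp only [star_sub, star_def, conj_I, star_one]
    linear_combination -I_sq
  linear_combination (norm := module) this • P

section OneAdd

variable {u : unitaryGroup (Fin d) ℂ} {P : Matrix (Fin d) (Fin d) ℂ} (hP : IsStarProjection P)
  (hu : (u : Matrix (Fin d) (Fin d) ℂ) = 1 + (I - 1) • P)

include hP hu

lemma conjEnd_pow_one_add_apply (k : ℕ) (X : Matrix (Fin d) (Fin d) ℂ) :
    (conjEnd u ^ k) X = X + (I ^ k - 1) • (P * X) + ((-I) ^ k - 1) • (X * P) +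
      ((I ^ k - 1) * ((-I) ^ k - 1)) • (P * X * P) := by
  have h1 : Pᴴ = P := hP.isSelfAdjoint
  have h2 : P * P = P := hP.isIdempotentElem
  have hk : ((u ^ k : unitaryGroup (Fin d) ℂ) : Matrix (Fin d) (Fin d) ℂ) =
      1 + (I ^ k - 1) • P := by
    induction k with
    | zero => simp
    | succ k ih =>
      rw [pow_succ, UnitaryGroup.mul_val, ih, hu]
      simp only [add_mul, mul_add, one_mul, mul_one, smul_mul_smul_comm, h2]
      rw [add_assoc, ← add_smul, ← add_smul]
      congr 2
      ring
  rw [conjEnd_pow, conjEnd_apply, hk]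
  simp only [conjTranspose_add, conjTranspose_one, conjTranspose_smul, h1, add_mul, mul_add,
    one_mul, mul_one, smul_mul_assoc, mul_smul_comm, star_sub, star_pow, star_def, conj_I, star_one,
    smul_add, smul_smul]
  rw [mul_comm ((-I) ^ k - 1)]
  abel

/-- The conjugation is exp((iπ/2) ad P), with eigenvalues among 1, i, -i; x - x³ takes the values 0,
2i, -2i there. -/
lemma conjEnd_one_add_sub_pow_three : conjEnd u - conjEnd u ^ 3 = (2 * I) • ad P := by
  ext1 X
  have h1 := conjEnd_pow_one_add_apply hP hu 1 X
  have h3 := conjEnd_pow_one_add_apply hP hu 3 X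
  rw [pow_one] at h1
  rw [LinearMap.sub_apply, h1, h3, LinearMap.smul_apply, ad_apply]
  have e1 : I ^ 3 = -I := I_pow_three
  have e2 : (-I) ^ 3 = I := by rw [neg_pow, e1]; ring
  rw [e1, e2]
  module

lemma conjEnd_one_add_polynomial :
    conjEnd u ^ 3 - conjEnd u ^ 2 + conjEnd u - 1 = 0 := by
  ext1 X
  have h1 := conjEnd_pow_one_add_apply hP hu 1 X
  have h2 := conjEnd_pow_one_add_apply hP hu 2 X
  have h3 := conjEnd_pow_one_add_apply hP hu 3 X
  rw [pow_one] at h1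
  rw [LinearMap.sub_apply, LinearMap.add_apply, LinearMap.sub_apply, h1, h2, h3]
  have e1 : I ^ 3 = -I := I_pow_three
  have e2 : (-I) ^ 3 = I := by rw [neg_pow, e1]; ring
  have e3 : (I - 1) * (-I - 1) = 2 := by linear_combination -I_sq
  rw [e1, e2, neg_sq, I_sq, pow_one, pow_one, mul_comm (-I - 1), e3]
  simp only [Module.End.one_apply, LinearMap.zero_apply]
  module

end OneAdd

lemma star_mul_self_eq_one_of_mulVec_eq_smul (w : unitaryGroup (Fin d) ℂ) {a : ℂ}
    {v : Fin d → ℂ} (hv : v ≠ 0) (h : (w : Matrix (Fin d) (Fin d) ℂ) *ᵥ v = a • v) :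
    star a * a = 1 := by
  have hw : (w : Matrix (Fin d) (Fin d) ℂ)ᴴ * (w : Matrix (Fin d) (Fin d) ℂ) = 1 :=
    UnitaryGroup.star_mul_self w
  have h1 : star ((w : Matrix (Fin d) (Fin d) ℂ) *ᵥ v) ⬝ᵥ ((w : Matrix (Fin d) (Fin d) ℂ) *ᵥ v) =
      star v ⬝ᵥ v := by
    rw [star_mulVec, ← dotProduct_mulVec, mulVec_mulVec, hw, one_mulVec]
  rw [h, star_smul, smul_dotProduct, dotProduct_smul, smul_eq_mul, smul_eq_mul, ← mul_assoc] at h1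
  exact mul_right_cancel₀ (mt dotProduct_star_self_eq_zero.1 (by simpa [dotProduct_comm] using hv))
    (h1.trans (one_mul _).symm)

/-- A unitary matrix fixing a nonzero vector satisfies the polynomial equation
that conjugation by it satisfies. -/
lemma polynomial_of_conjEnd_polynomial {x : unitaryGroup (Fin d) ℂ}
    (hx : conjEnd x ^ 3 - conjEnd x ^ 2 + conjEnd x - 1 = 0) {v : Fin d → ℂ} (hv : v ≠ 0)
    (h : (x : Matrix (Fin d) (Fin d) ℂ) *ᵥ v = v) :
    (x : Matrix (Fin d) (Fin d) ℂ) ^ 3 - (x : Matrix (Fin d) (Fin d) ℂ) ^ 2 + x - 1 = 0 := by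
  -- On matrices y v† the right factor x† acts trivially, so conjugation reduces to multiplication
  -- by x.
  have hk : ∀ (k : ℕ) (y : Fin d → ℂ), (conjEnd x ^ k) (vecMulVec y (star v)) =
      vecMulVec (((x : Matrix (Fin d) (Fin d) ℂ) ^ k) *ᵥ y) (star v) := by
    intro k y
    induction k with
    | zero => simp
    | succ k ih =>
      rw [pow_succ', Module.End.mul_apply, ih, conjEnd_apply, mul_vecMulVec, vecMulVec_mul,
        ← star_mulVec, h, mulVec_mulVec, ← pow_succ']
  refine Matrix.toLin'.injective (LinearMap.ext fun y => ?_)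
  have h0 := LinearMap.congr_fun hx (vecMulVec y (star v))
  rw [LinearMap.sub_apply, LinearMap.add_apply, LinearMap.sub_apply, hk, hk,
    ← pow_one (conjEnd x), hk, ← pow_zero (conjEnd x), hk, ← sub_vecMulVec, ← add_vecMulVec,
    ← sub_vecMulVec, LinearMap.zero_apply, vecMulVec_eq_zero] at h0
  rcases h0 with h0 | h0
  · simpa [sub_mulVec, add_mulVec, ← Matrix.toLin'_pow] using h0
  · exact absurd (star_eq_zero.1 h0) hv

lemma exists_isStarProjection_of_sq {x : unitaryGroup (Fin d) ℂ}
    (hx : (x : Matrix (Fin d) (Fin d) ℂ) * x = (1 + I) • (x : Matrix (Fin d) (Fin d) ℂ) - I • 1) :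
    ∃ Q : Matrix (Fin d) (Fin d) ℂ, IsStarProjection Q ∧
      (x : Matrix (Fin d) (Fin d) ℂ) = 1 + (I - 1) • Q := by
  have hI : I - 1 ≠ 0 := by
    intro h
    have := congrArg Complex.im h
    simp at this
  have hxx : (x : Matrix (Fin d) (Fin d) ℂ) * (x : Matrix (Fin d) (Fin d) ℂ)ᴴ = 1 :=
    Unitary.coe_mul_star_self x
  -- Unitarity turns the quadratic relation into a formula for x† = x⁻¹, linear in x; this makes
  -- (x-1)/(i-1) self-adjoint.
  have hs : (x : Matrix (Fin d) (Fin d) ℂ)ᴴ = (1 - I) • 1 + I • (x : Matrix (Fin d) (Fin d) ℂ) := by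
    have h := congrArg (fun Y => Y * (x : Matrix (Fin d) (Fin d) ℂ)ᴴ) hx
    simp only [Matrix.mul_assoc, hxx, sub_mul, smul_mul_assoc, one_mul, mul_one] at h
    have h' : I • (x : Matrix (Fin d) (Fin d) ℂ)ᴴ = (1 + I) • 1 - (x : Matrix (Fin d) (Fin d) ℂ) :=
      eq_sub_of_add_eq' (sub_eq_iff_eq_add.1 h.symm).symm
    have e1 : -I * I = 1 := by simp
    have e2 : -I * (1 + I) = 1 - I := by linear_combination -I_sq
    have h'' := congrArg (fun Y => (-I) • Y) h'
    simp only [smul_sub, smul_smul, e1, e2, one_smul] at h''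
    rw [h'']
    module
  refine ⟨(I - 1)⁻¹ • ((x : Matrix (Fin d) (Fin d) ℂ) - 1), ⟨?_, ?_⟩, ?_⟩
  · rw [IsIdempotentElem, smul_mul_smul_comm]
    have : ((x : Matrix (Fin d) (Fin d) ℂ) - 1) * ((x : Matrix (Fin d) (Fin d) ℂ) - 1) =
        (I - 1) • ((x : Matrix (Fin d) (Fin d) ℂ) - 1) := by
      rw [sub_mul, mul_sub, hx, mul_one, one_mul]
      module
    rw [this, smul_smul, mul_assoc, inv_mul_cancel₀ hI, mul_one]
  · rw [IsSelfAdjoint, star_smul, star_sub, star_one, star_eq_conjTranspose, hs]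
    have : ((1 - I) • (1 : Matrix (Fin d) (Fin d) ℂ) + I • (x : Matrix (Fin d) (Fin d) ℂ) - 1) =
        I • ((x : Matrix (Fin d) (Fin d) ℂ) - 1) := by module
    rw [this, smul_smul]
    congr 1
    rw [star_inv₀, inv_mul_eq_iff_eq_mul₀ (star_ne_zero.2 hI), ← div_eq_mul_inv, eq_div_iff hI]
    simp only [star_sub, star_def, conj_I, star_one]
    linear_combination I_sq
  · rw [smul_smul, mul_inv_cancel₀ hI, one_smul]
    abel

/-- Once the phase makes 1 an eigenvalue, the spectrum lies in {1, i, -i}. Both i and -i cannot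
occur, as their ratio -1 is not a root of the polynomial; if i does not occur, multiplying by i
turns {1, -i} into {i, 1}. -/
lemma exists_smul_sq_of_conjEnd_polynomial (hd : d ≠ 0) {w : unitaryGroup (Fin d) ℂ}
    (hw : conjEnd w ^ 3 - conjEnd w ^ 2 + conjEnd w - 1 = 0) :
    ∃ x : unitaryGroup (Fin d) ℂ, conjEnd x = conjEnd w ∧
      (x : Matrix (Fin d) (Fin d) ℂ) * x = (1 + I) • (x : Matrix (Fin d) (Fin d) ℂ) - I • 1 := by
  have : NeZero d := ⟨hd⟩
  obtain ⟨a, ha⟩ := Module.End.exists_eigenvalue (Matrix.toLin' (w : Matrix (Fin d) (Fin d) ℂ))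
  obtain ⟨v, hv⟩ := ha.exists_hasEigenvector
  have hwv : (w : Matrix (Fin d) (Fin d) ℂ) *ᵥ v = a • v := hv.apply_eq_smul
  have haa := star_mul_self_eq_one_of_mulVec_eq_smul w hv.2 hwv
  obtain ⟨x, hxw, hx⟩ := exists_unitary_eq_smul w (c := star a) (by rw [star_star, mul_comm, haa])
  have hxv : (x : Matrix (Fin d) (Fin d) ℂ) *ᵥ v = v := by
    rw [hxw, smul_mulVec, hwv, smul_smul, haa, one_smul]
  have hpx := polynomial_of_conjEnd_polynomial (by rw [hx]; exact hw) hv.2 hxv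
  have hII : star I * I = 1 := by simp
  have hII' : star (-I) * (-I) = 1 := by simp
  by_cases hdet : ((x : Matrix (Fin d) (Fin d) ℂ) - I • 1).det = 0
  · obtain ⟨v', hv', h'⟩ := Matrix.exists_mulVec_eq_zero_iff.2 hdet
    rw [sub_mulVec, smul_mulVec, one_mulVec, sub_eq_zero] at h'
    obtain ⟨y, hyx, hy⟩ := exists_unitary_eq_smul x hII'
    have hyv : (y : Matrix (Fin d) (Fin d) ℂ) *ᵥ v' = v' := by
      rw [hyx, smul_mulVec, h', smul_smul, neg_mul, I_mul_I, neg_neg, one_smul]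
    have hpy := polynomial_of_conjEnd_polynomial (by rw [hy, hx]; exact hw) hv' hyv
    refine ⟨x, hx, ?_⟩
    rw [hyx, smul_pow, smul_pow, neg_sq, I_sq] at hpy
    have e2 : (-I) ^ 3 = I := by rw [neg_pow, I_pow_three]; ring
    rw [e2] at hpy
    have h2 : (1 + I) * ((1 - I) / 2) = 1 := by linear_combination -(1/2) * I_sq
    generalize (x : Matrix (Fin d) (Fin d) ℂ) = Y at hpx hpy ⊢
    -- Eliminating Y³ between the relations for Y and for -iY leaves (Y-1)(Y-i) = 0.
    have h3 : (1 + I) • (Y * Y - ((1 + I) • Y - I • 1)) = 0 := by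
      have : (1 + I) • (Y * Y - ((1 + I) • Y - I • 1)) =
        (I • Y ^ 3 - (-1 : ℂ) • Y ^ 2 + (-I) • Y - 1) - I • (Y ^ 3 - Y ^ 2 + Y - 1) := by
        rw [← sq, smul_sub, smul_sub, smul_smul, smul_smul]
        have e3 : (1 + I) * (1 + I) = 2 * I := by linear_combination I_sq
        have e4 : (1 + I) * I = I - 1 := by linear_combination I_sq
        rw [e3, e4]
        module
      rw [this, hpx, hpy, smul_zero, sub_zero]
    rw [smul_eq_zero] at h3
    rcases h3 with h3 | h3
    · rw [h3, zero_mul] at h2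
      exact absurd h2 zero_ne_one
    · exact sub_eq_zero.1 h3
  · obtain ⟨y, hyx, hy⟩ := exists_unitary_eq_smul x hII
    refine ⟨y, hy.trans hx, ?_⟩
    rw [hyx]
    generalize (x : Matrix (Fin d) (Fin d) ℂ) = Y at hpx hdet ⊢
    have hu : IsUnit (Y - I • 1) := (Matrix.isUnit_iff_isUnit_det _).2 (isUnit_iff_ne_zero.2 hdet)
    have h3 : (Y - I • 1) * (Y * Y - (1 - I) • Y - I • 1) = 0 := by
      rw [← hpx]
      simp only [sub_mul, mul_sub, smul_mul_assoc, mul_smul_comm, one_mul, mul_one, smul_sub,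
        smul_smul, I_mul_I, pow_succ, pow_zero, Matrix.mul_assoc]
      module
    have h4 := (hu.mul_right_eq_zero).1 h3
    rw [smul_mul_smul_comm, I_mul_I, smul_smul]
    have h5 : Y * Y = (1 - I) • Y + I • 1 := by
      rw [← sub_eq_zero, ← h4]
      abel
    have e4 : (1 + I) * I = I - 1 := by linear_combination I_sq
    rw [h5, e4]
    module

lemma exists_isStarProjection_of_conjEnd_polynomial (hd : d ≠ 0) {w : unitaryGroup (Fin d) ℂ}
    (hw : conjEnd w ^ 3 - conjEnd w ^ 2 + conjEnd w - 1 = 0) :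
    ∃ Q : Matrix (Fin d) (Fin d) ℂ, IsStarProjection Q ∧
      conjEnd w - conjEnd w ^ 3 = (2 * I) • ad Q := by
  obtain ⟨x, hx, h⟩ := exists_smul_sq_of_conjEnd_polynomial hd hw
  obtain ⟨Q, hQ, hxQ⟩ := exists_isStarProjection_of_sq h
  exact ⟨Q, hQ, by rw [← hx, conjEnd_one_add_sub_pow_three hQ hxQ]⟩

/-! ### Transporting rank-one projections through φ, up to a global sign -/

lemma star_dotProduct_eq_zero_symm {v w : Fin d → ℂ} (h : star v ⬝ᵥ w = 0) :
    star w ⬝ᵥ v = 0 := by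
  rw [← star_star (star w ⬝ᵥ v), ← star_dotProduct_star, star_star, star_eq_zero]
  exact h

section Intertwine

variable {φ : Module.End ℂ (Matrix (Fin d) (Fin d) ℂ) ≃ₐ[ℂ]
  Module.End ℂ (Matrix (Fin d) (Fin d) ℂ)}

lemma trace_ad_mul_ad_of_eq_smul {s : ℂ} (hs : s * s = 1) {A A' B B' : Matrix (Fin d) (Fin d) ℂ}
    (hA : ad A = s • φ (ad A')) (hB : ad B = s • φ (ad B')) (htA : A'.trace = A.trace)
    (htB : B'.trace = B.trace) (hd : d ≠ 0) : (A' * B').trace = (A * B).trace := by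
  have h := trace_ad_mul_ad A B
  rw [hA, hB, smul_mul_smul_comm, hs, one_smul, ← map_mul, LinearMap.trace_map, trace_ad_mul_ad,
    htA, htB] at h
  have hd' : (2 * d : ℂ) ≠ 0 := by simp [hd]
  exact mul_left_cancel₀ hd' (by linear_combination h)

lemma exists_isStarProjection_ad_eq (hd : 2 ≤ d)
    (hφ : ∀ u : unitaryGroup (Fin d) ℂ, ∃ w : unitaryGroup (Fin d) ℂ, conjEnd u = φ (conjEnd w))
    {v : Fin d → ℂ} (hv : star v ⬝ᵥ v = 1) :
    ∃ Q : Matrix (Fin d) (Fin d) ℂ, IsStarProjection Q ∧ ad (outer v) = φ (ad Q) ∧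
      (Q.trace = 1 ∨ Q.trace = d - 1) := by
  have hP := isStarProjection_outer hv
  obtain ⟨u, hu⟩ := exists_unitary_eq_one_add hP
  obtain ⟨w, hw⟩ := hφ u
  obtain ⟨Q, hQ, hwQ⟩ := exists_isStarProjection_of_conjEnd_polynomial (w := w) (by omega) <|
    φ.injective <| by
      rw [map_sub, map_add, map_sub, map_pow, map_pow, map_one, map_zero, ← hw]
      exact conjEnd_one_add_polynomial hP hu
  have hI : (2 * I : ℂ) ≠ 0 := by simp
  have hPQ : ad (outer v) = φ (ad Q) := by
    refine smul_right_injective _ hI ?_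
    simp only
    rw [← map_smul φ, ← hwQ, map_sub, map_pow, ← hw, conjEnd_one_add_sub_pow_three hP hu]
  refine ⟨Q, hQ, hPQ, ?_⟩
  have h := trace_ad_mul_ad (outer v) (outer v)
  rw [hPQ, ← map_mul, LinearMap.trace_map, trace_ad_mul_ad, hP.isIdempotentElem.eq,
    hQ.isIdempotentElem.eq, trace_outer hv] at h
  -- Equality of the trace forms reads tr Q (d - tr Q) = d - 1.
  have h0 : (Q.trace - 1) * (Q.trace - (d - 1)) = 0 := by linear_combination -h / 2
  rcases mul_eq_zero.1 h0 with h1 | h1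
  · exact Or.inl (sub_eq_zero.1 h1)
  · exact Or.inr (sub_eq_zero.1 h1)

lemma ad_one_sub (Q : Matrix (Fin d) (Fin d) ℂ) : ad (1 - Q) = -ad Q := by
  rw [map_sub, ad_one, zero_sub]

/-- `ad |v⟩⟨v|` corresponds under `φ` to `s` times the commutator map of a rank-one projection. -/
def AdOuterEq (φ : Module.End ℂ (Matrix (Fin d) (Fin d) ℂ) ≃ₐ[ℂ]
    Module.End ℂ (Matrix (Fin d) (Fin d) ℂ)) (s : ℂ) (v : Fin d → ℂ) : Prop :=
  ∃ Q : Matrix (Fin d) (Fin d) ℂ, IsStarProjection Q ∧ Q.trace = 1 ∧ ad (outer v) = s • φ (ad Q)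

lemma adOuterEq_or (hd : 2 ≤ d)
    (hφ : ∀ u : unitaryGroup (Fin d) ℂ, ∃ w : unitaryGroup (Fin d) ℂ, conjEnd u = φ (conjEnd w))
    {v : Fin d → ℂ} (hv : star v ⬝ᵥ v = 1) : AdOuterEq φ 1 v ∨ AdOuterEq φ (-1) v := by
  obtain ⟨Q, hQ, h, ht | ht⟩ := exists_isStarProjection_ad_eq hd hφ hv
  · exact Or.inl ⟨Q, hQ, ht, by rw [h, one_smul]⟩
  · exact Or.inr ⟨1 - Q, hQ.one_sub, by simp [ht], by rw [ad_one_sub, h]; simp⟩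

/-- With opposite signs Q and R would commute, so tr(QR) is a natural number n, while the trace form
forces d n = 2. -/
lemma not_adOuterEq_of_orthogonal (hd : 3 ≤ d) {v w : Fin d → ℂ} (hv : star v ⬝ᵥ v = 1)
    (hw : star w ⬝ᵥ w = 1) (hvw : star v ⬝ᵥ w = 0) (h1 : AdOuterEq φ 1 v) :
    ¬ AdOuterEq φ (-1) w := by
  rintro ⟨R, hR, hRt, hR'⟩
  obtain ⟨Q, hQ, hQt, hQ'⟩ := h1
  rw [one_smul] at hQ'
  rw [← map_smul, ← map_smul] at hR'
  have hwv := star_dotProduct_eq_zero_symm hvw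
  have hcomm' : Q * ((-1 : ℂ) • R) - ((-1 : ℂ) • R) * Q = 0 := by
    refine eq_zero_of_ad_eq_zero (φ.injective ?_) (by rw [trace_sub, trace_mul_comm, sub_self])
    have h := ad_commutator (outer v) (outer w)
    rw [outer_mul_outer_eq_zero hvw, outer_mul_outer_eq_zero hwv, sub_zero, map_zero, hQ', hR'] at h
    rw [ad_commutator, map_sub, map_mul, map_mul, map_zero, h]
  have hcomm : Q * R = R * Q := by
    rw [mul_smul_comm, smul_mul_assoc, ← smul_sub] at hcomm'
    exact sub_eq_zero.1 ((smul_eq_zero.1 hcomm').resolve_left (by norm_num))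
  have htr := trace_ad_mul_ad (outer v) (outer w)
  rw [outer_mul_outer_eq_zero hvw, trace_outer hv, trace_outer hw, hQ', hR', ← map_mul,
    LinearMap.trace_map, trace_ad_mul_ad, mul_smul_comm, trace_smul, trace_smul, hQt, hRt,
    trace_zero, smul_eq_mul, smul_eq_mul] at htr
  have hidem : IsIdempotentElem (Q * R) :=
    hQ.isIdempotentElem.mul_of_commute hcomm hR.isIdempotentElem
  obtain ⟨n, hn⟩ := exists_trace_eq_natCast hidem
  rw [hn] at htr
  have h2 : (d : ℂ) * n = 2 := by linear_combination -htr / 2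
  have h3 : d * n = 2 := by exact_mod_cast h2
  have := Nat.le_of_dvd two_pos (Dvd.intro n h3)
  omega

lemma exists_sign_adOuterEq (hd : 2 ≤ d)
    (hφ : ∀ u : unitaryGroup (Fin d) ℂ, ∃ w : unitaryGroup (Fin d) ℂ, conjEnd u = φ (conjEnd w)) :
    ∃ s : ℂ, (s = 1 ∨ s = -1) ∧ ∀ v : Fin d → ℂ, star v ⬝ᵥ v = 1 → AdOuterEq φ s v := by
  -- For d = 2 the two possible traces 1 and d - 1 coincide, so no sign is needed.
  rcases hd.eq_or_lt with hd2 | hd3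
  · refine ⟨1, Or.inl rfl, fun v hv => ?_⟩
    obtain ⟨Q, hQ, h, ht⟩ := exists_isStarProjection_ad_eq hd hφ hv
    refine ⟨Q, hQ, ?_, by rw [h, one_smul]⟩
    rcases ht with ht | ht
    · exact ht
    · rw [ht, ← hd2]
      norm_num
  · by_cases hall : ∀ v : Fin d → ℂ, star v ⬝ᵥ v = 1 → AdOuterEq φ (-1) v
    · exact ⟨-1, Or.inr rfl, hall⟩
    · push Not at hall
      obtain ⟨a, ha, ha'⟩ := hall
      refine ⟨1, Or.inl rfl, fun v hv => ?_⟩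
      obtain ⟨b, hb, hab, hvb⟩ := exists_orthogonal_pair hd3 a v
      have h1 := (adOuterEq_or hd hφ ha).resolve_right ha'
      have h2 := (adOuterEq_or hd hφ hb).resolve_right
        (not_adOuterEq_of_orthogonal hd3 ha hb hab h1)
      have hbv : star b ⬝ᵥ v = 0 := star_dotProduct_eq_zero_symm hvb
      exact (adOuterEq_or hd hφ hv).resolve_right (not_adOuterEq_of_orthogonal hd3 hb hv hbv h2)

/-! ### The induced map θ on matrices and its multiplicativity -/

/-- Existence extends linearly from rank-one projections, which span; `ext_of_ad_eq` gives
uniqueness, hence linearity and injectivity. -/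
lemma exists_linearEquiv_ad_eq {s : ℂ} (hs : s * s = 1)
    (h : ∀ v : Fin d → ℂ, star v ⬝ᵥ v = 1 → AdOuterEq φ s v) :
    ∃ θ : InvMap d, (∀ X, ad X = s • φ (ad (θ X))) ∧ (∀ X, (θ X).trace = X.trace) ∧
      ∀ v : Fin d → ℂ, star v ⬝ᵥ v = 1 → IsStarProjection (θ (outer v)) := by
  have hs0 : s ≠ 0 := left_ne_zero_of_mul_eq_one hs
  have huniq : ∀ Y Z : Matrix (Fin d) (Fin d) ℂ, s • φ (ad Y) = s • φ (ad Z) →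
      Y.trace = Z.trace → Y = Z := fun Y Z hYZ ht =>
    ext_of_ad_eq (φ.injective (smul_right_injective _ hs0 hYZ)) ht
  have hex : ∀ X : Matrix (Fin d) (Fin d) ℂ, ∃ Y : Matrix (Fin d) (Fin d) ℂ,
      ad X = s • φ (ad Y) ∧ Y.trace = X.trace := by
    intro X
    have hX : X ∈ Submodule.span ℂ (outer '' {v : Fin d → ℂ | star v ⬝ᵥ v = 1}) := by
      rw [span_outer_eq_top]
      trivial
    induction hX using Submodule.span_induction with
    | mem x hx =>
      obtain ⟨v, hv, rfl⟩ := hx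
      obtain ⟨Q, -, ht, hQ⟩ := h v hv
      exact ⟨Q, hQ, by rw [ht, trace_outer hv]⟩
    | zero => exact ⟨0, by simp, rfl⟩
    | add x y _ _ hx hy =>
      obtain ⟨x', hx, hx'⟩ := hx
      obtain ⟨y', hy, hy'⟩ := hy
      exact ⟨x' + y', by simp [hx, hy], by simp [hx', hy']⟩
    | smul c x _ hx =>
      obtain ⟨x', hx, hx'⟩ := hx
      exact ⟨c • x', by simp [hx, smul_comm c s], by simp [hx']⟩
  choose f hf hft using hex
  let θ : Matrix (Fin d) (Fin d) ℂ →ₗ[ℂ] Matrix (Fin d) (Fin d) ℂ :=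
    { toFun := f
      map_add' := fun X Y => huniq _ _
        (by rw [← hf, map_add, map_add, map_add, smul_add, ← hf, ← hf])
        (by rw [hft, trace_add, trace_add, hft, hft])
      map_smul' := fun c X => huniq _ _
        (by rw [← hf, RingHom.id_apply, map_smul, map_smul, map_smul, smul_comm s c, ← hf])
        (by rw [hft, RingHom.id_apply, trace_smul, trace_smul, hft]) }
  have hθ : Function.Injective θ := fun X Y hXY => by
    have hXY' : f X = f Y := hXY
    exact ext_of_ad_eq (by rw [hf X, hf Y, hXY']) (by rw [← hft X, ← hft Y, hXY'])
  refine ⟨LinearEquiv.ofInjectiveEndo θ hθ, hf, hft, fun v hv => ?_⟩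
  obtain ⟨Q, hQ, ht, hQ'⟩ := h v hv
  have : θ (outer v) = Q := huniq _ _ (by rw [← hQ']; exact (hf _).symm)
    (by rw [ht, ← trace_outer hv]; exact hft _)
  rw [LinearEquiv.coe_ofInjectiveEndo, this]
  exact hQ

section Theta

variable {s : ℂ} {θ : InvMap d} (hd : d ≠ 0) (hs : s * s = 1) (had : ∀ X, ad X = s • φ (ad (θ X)))
  (htr : ∀ X, (θ X).trace = X.trace)
  (hproj : ∀ v : Fin d → ℂ, star v ⬝ᵥ v = 1 → IsStarProjection (θ (outer v)))

include hproj in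
lemma map_conjTranspose_of_isStarProjection_outer (X : Matrix (Fin d) (Fin d) ℂ) :
    θ Xᴴ = (θ X)ᴴ := by
  have hX : X ∈ Submodule.span ℂ (outer '' {v : Fin d → ℂ | star v ⬝ᵥ v = 1}) := by
    rw [span_outer_eq_top]
    trivial
  induction hX using Submodule.span_induction with
  | mem x hx =>
    obtain ⟨v, hv, rfl⟩ := hx
    rw [show (outer v)ᴴ = outer v from (isStarProjection_outer hv).isSelfAdjoint]
    exact (hproj v hv).isSelfAdjoint.symm
  | zero => simp
  | add x y _ _ hx hy => simp [hx, hy]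
  | smul c x _ hx => simp [hx]

include hs had htr in
lemma map_commutator_of_ad_eq (A B : Matrix (Fin d) (Fin d) ℂ) :
    θ A * θ B - θ B * θ A = s • θ (A * B - B * A) := by
  have hs0 : s ≠ 0 := left_ne_zero_of_mul_eq_one hs
  refine ext_of_ad_eq (φ.injective ?_) ?_
  · rw [map_smul, map_smul, ← had, ad_commutator, ad_commutator, map_sub, map_mul, map_mul, had A,
      had B, smul_mul_smul_comm, smul_mul_smul_comm, hs, one_smul, one_smul]
  · simp [htr, trace_mul_comm A B, trace_mul_comm (θ A)]

include hd hs had htr hproj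

/-- The trace form makes θ preserve tr(AB), so orthogonal rank-one projections have orthogonal
images and a spectral decomposition is carried to one. -/
lemma map_mul_self_of_isHermitian {H : Matrix (Fin d) (Fin d) ℂ} (hH : H.IsHermitian) :
    θ (H * H) = θ H * θ H := by
  obtain ⟨c, v, hv, rfl⟩ := hH.exists_eq_sum_smul_outer
  have hv1 : ∀ i, star (v i) ⬝ᵥ v i = 1 := fun i => by simp [hv]
  have hP : ∀ i j, outer (v i) * outer (v j) = if i = j then outer (v i) else 0 := by
    intro i j
    split_ifs with hij
    · subst hij
      exact (isStarProjection_outer (hv1 i)).isIdempotentElem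
    · exact outer_mul_outer_eq_zero (by rw [hv, if_neg hij])
  have hQ : ∀ i j, θ (outer (v i)) * θ (outer (v j)) = if i = j then θ (outer (v i)) else 0 := by
    intro i j
    split_ifs with hij
    · subst hij
      exact (hproj _ (hv1 i)).isIdempotentElem
    · refine mul_eq_zero_of_trace_mul_eq_zero (hproj _ (hv1 i)) (hproj _ (hv1 j)) ?_
      rw [trace_ad_mul_ad_of_eq_smul hs (had _) (had _) (htr _) (htr _) hd, hP, if_neg hij,
        trace_zero]
  simp only [Finset.sum_mul_sum, smul_mul_smul_comm, map_sum, map_smul, hP, hQ, smul_ite, smul_zero,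
    Finset.sum_ite_eq, Finset.mem_univ, if_true]

lemma map_mul_self_of_ad_eq (X : Matrix (Fin d) (Fin d) ℂ) : θ (X * X) = θ X * θ X := by
  have key := fun {H : Matrix (Fin d) (Fin d) ℂ} (hH : H.IsHermitian) => map_mul_self_of_isHermitian hd hs had htr hproj hH
  obtain ⟨A, B, hA, hB, rfl⟩ : ∃ A B : Matrix (Fin d) (Fin d) ℂ, A.IsHermitian ∧ B.IsHermitian ∧
      A + I • B = X :=
    ⟨realPart X, imaginaryPart X, (realPart X).2, (imaginaryPart X).2,
      realPart_add_I_smul_imaginaryPart X⟩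
  -- Polarisation: the square of A + B supplies the cross term AB + BA.
  have h := key (hA.add hB)
  simp only [add_mul, mul_add, map_add, key hA, key hB] at h
  simp only [add_mul, mul_add, map_add, key hA, key hB, map_smul, smul_mul_assoc, mul_smul_comm]
  linear_combination (norm := module) I • h

/-- Half the sum of the anticommutator and commutator identities; s decides the order of the
factors. -/
lemma map_mul_or_map_mul_reverse (hs1 : s = 1 ∨ s = -1) :
    (∀ A B, θ (A * B) = θ A * θ B) ∨ (∀ A B, θ (A * B) = θ B * θ A) := by
  have h1 : ∀ A B, θ (A * B) + θ (B * A) = θ A * θ B + θ B * θ A := by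
    intro A B
    have h := map_mul_self_of_ad_eq hd hs had htr hproj (A + B)
    simp only [add_mul, mul_add, map_add, map_mul_self_of_ad_eq hd hs had htr hproj A,
      map_mul_self_of_ad_eq hd hs had htr hproj B] at h
    linear_combination (norm := module) h
  have h2 := map_commutator_of_ad_eq hs had htr
  have h3 : ((1 : ℂ) / 2) + 1 / 2 = 1 := by norm_num
  rcases hs1 with rfl | rfl
  · refine Or.inl fun A B => ?_
    have e1 := h1 A B
    have e2 := h2 A B
    rw [map_sub] at e2
    linear_combination (norm := module) (1 / 2 : ℂ) • e1 - (1 / 2 : ℂ) • e2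
  · refine Or.inr fun A B => ?_
    have e1 := h1 A B
    have e2 := h2 A B
    rw [map_sub] at e2
    linear_combination (norm := module) (1 / 2 : ℂ) • e1 + (1 / 2 : ℂ) • e2

end Theta

lemma map_conjEnd_of_ad_eq {s : ℂ} {θ : InvMap d} (hs : s * s = 1)
    (had : ∀ X, ad X = s • φ (ad (θ X))) (htr : ∀ X, (θ X).trace = X.trace)
    {u w : unitaryGroup (Fin d) ℂ} (huw : conjEnd u = φ (conjEnd w))
    (X : Matrix (Fin d) (Fin d) ℂ) : θ (conjEnd u X) = conjEnd w (θ X) := by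
  have hs0 : s ≠ 0 := left_ne_zero_of_mul_eq_one hs
  have hconj : ∀ (u : unitaryGroup (Fin d) ℂ) (A : Matrix (Fin d) (Fin d) ℂ),
      ad (conjEnd u A) * conjEnd u = conjEnd u * ad A := by
    intro u A
    have hu : (u : Matrix (Fin d) (Fin d) ℂ)ᴴ * (u : Matrix (Fin d) (Fin d) ℂ) = 1 :=
      UnitaryGroup.star_mul_self u
    ext1 Y
    simp only [Module.End.mul_apply, ad_apply, conjEnd_apply, mul_sub, sub_mul]
    have hu' : ∀ Z : Matrix (Fin d) (Fin d) ℂ,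
        (u : Matrix (Fin d) (Fin d) ℂ)ᴴ * ((u : Matrix (Fin d) (Fin d) ℂ) * Z) = Z := fun Z => by
      rw [← Matrix.mul_assoc, hu, one_mul]
    simp only [Matrix.mul_assoc, hu']
  have htc : ∀ (u : unitaryGroup (Fin d) ℂ) (A : Matrix (Fin d) (Fin d) ℂ),
      (conjEnd u A).trace = A.trace := by
    intro u A
    have hu : (u : Matrix (Fin d) (Fin d) ℂ)ᴴ * (u : Matrix (Fin d) (Fin d) ℂ) = 1 :=
      UnitaryGroup.star_mul_self u
    rw [conjEnd_apply, trace_mul_comm, ← Matrix.mul_assoc, hu, one_mul]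
  refine ext_of_ad_eq ?_ (by rw [htr, htc, htc, htr])
  have hunit : IsUnit (conjEnd w) :=
    ⟨⟨conjEnd w, conjEnd w⁻¹, by rw [← conjEnd_mul, mul_inv_cancel, conjEnd_one],
      by rw [← conjEnd_mul, inv_mul_cancel, conjEnd_one]⟩, rfl⟩
  refine hunit.mul_right_cancel (φ.injective (smul_right_injective _ hs0 ?_))
  simp only
  rw [map_mul, ← smul_mul_assoc, ← had, ← huw, hconj, hconj, map_mul, ← huw, had X, mul_smul_comm]

end Intertwine

/-! ### From (anti)automorphisms to symmetries, and the conclusion -/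

/-- A bijective linear multiplicative star-preserving map on matrices is a unitary conjugation. -/
lemma exists_unitary_of_map_mul {θ : InvMap d} (hmul : ∀ A B, θ (A * B) = θ A * θ B)
    (hstar : ∀ A, θ Aᴴ = (θ A)ᴴ) : θ ∈ unitaryMaps d := by
  let f : Matrix (Fin d) (Fin d) ℂ ≃ₐ[ℂ] Matrix (Fin d) (Fin d) ℂ :=
    AlgEquiv.ofLinearEquiv θ (by
      obtain ⟨X, hX⟩ := θ.surjective 1
      have h := hmul 1 X
      rwa [one_mul, hX, mul_one, eq_comm] at h) hmul
  -- Skolem–Noether: θ is conjugation by an invertible A, and compatibility with † makes A†A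
  -- central, so A is a multiple of a unitary.
  obtain ⟨T, hT⟩ := ((Matrix.toLinAlgEquiv'.symm.trans f).trans
    Matrix.toLinAlgEquiv').eq_linearEquivConjAlgEquiv
  set A : Matrix (Fin d) (Fin d) ℂ := LinearMap.toMatrix' T.toLinearMap with hA
  have hθ : ∀ X, A * X = θ X * A := by
    intro X
    have h := AlgEquiv.congr_fun hT (Matrix.toLinAlgEquiv' X)
    refine Matrix.toLin'.injective (LinearMap.ext fun y => ?_)
    have h' := LinearMap.congr_fun h (T y)
    simp at h'
    simpa [hA, f] using h'.symm
  have hAinj : ∀ X, A * X = 0 → X = 0 := fun X h => by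
    have hA' : LinearMap.toMatrix' T.symm.toLinearMap * A = 1 := by
      rw [hA, ← LinearMap.toMatrix'_comp]
      simp
    rw [← one_mul X, ← hA', Matrix.mul_assoc, h, mul_zero]
  have hθ' : ∀ X, Aᴴ * θ X = X * Aᴴ := by
    intro X
    have h := congrArg conjTranspose (hθ Xᴴ)
    rw [hstar, conjTranspose_mul, conjTranspose_mul] at h
    simpa using h.symm
  obtain ⟨c, hc⟩ := mem_range_scalar_of_commute_single (M := Aᴴ * A) fun i j _ => by
    change single i j 1 * (Aᴴ * A) = Aᴴ * A * single i j 1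
    rw [Matrix.mul_assoc, hθ, ← Matrix.mul_assoc, ← Matrix.mul_assoc, hθ']
  rcases Nat.eq_zero_or_pos d with rfl | hd
  · exact ⟨1, LinearEquiv.ext fun X => Subsingleton.elim _ _⟩
  let i : Fin d := ⟨0, hd⟩
  set r : ℝ := ∑ k, ‖A k i‖ ^ 2 with hr
  have hcr : c = r := by
    have h := congrFun (congrFun hc i) i
    simp [mul_apply, Complex.conj_mul'] at h
    rw [h, hr]
    simp
  have hr0 : 0 < r := by
    refine lt_of_le_of_ne (Finset.sum_nonneg fun _ _ => by positivity) fun h0 => ?_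
    rw [hcr, ← h0] at hc
    have h1 : Aᴴ * A = 0 := by rw [← hc]; simp
    rw [conjTranspose_mul_self_eq_zero] at h1
    have := congrFun (congrFun (hAinj 1 (by rw [h1, zero_mul])) i) i
    simp at this
  have h1 : ((Real.sqrt r : ℝ) : ℂ) * (Real.sqrt r : ℝ) = r := by
    rw [← ofReal_mul, Real.mul_self_sqrt hr0.le]
  have h2 : ((Real.sqrt r : ℝ) : ℂ) ≠ 0 := by
    exact_mod_cast (Real.sqrt_pos.2 hr0).ne'
  have hu : ((Real.sqrt r : ℂ)⁻¹ • A)ᴴ * ((Real.sqrt r : ℂ)⁻¹ • A) = 1 := by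
    rw [conjTranspose_smul, smul_mul_smul_comm, ← hc, hcr, ← h1]
    ext i j
    simp only [star_inv₀, star_def, conj_ofReal, scalar_apply, Matrix.smul_apply, diagonal_apply,
      one_apply, smul_eq_mul, mul_ite, mul_zero]
    congr 1
    field_simp
  refine ⟨⟨(Real.sqrt r : ℂ)⁻¹ • A, mem_unitaryGroup_iff'.2 hu⟩, LinearEquiv.ext fun X => ?_⟩
  change θ X = ((Real.sqrt r : ℂ)⁻¹ • A) * X * ((Real.sqrt r : ℂ)⁻¹ • A)ᴴ
  rw [smul_mul_assoc, hθ, ← mul_smul_comm, Matrix.mul_assoc, mul_eq_one_comm.1 hu, mul_one]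

lemma ofUnitary_mul (u w : unitaryGroup (Fin d) ℂ) :
    ofUnitary (u * w) = ofUnitary u * ofUnitary w :=
  LinearEquiv.ext fun X => LinearMap.congr_fun (conjEnd_mul u w) X

lemma ofUnitary_one : ofUnitary (1 : unitaryGroup (Fin d) ℂ) = 1 :=
  LinearEquiv.ext fun X => LinearMap.congr_fun conjEnd_one X

lemma ofUnitary_inv (u : unitaryGroup (Fin d) ℂ) : ofUnitary u⁻¹ = (ofUnitary u)⁻¹ :=
  eq_inv_of_mul_eq_one_left (by rw [← ofUnitary_mul, inv_mul_cancel, ofUnitary_one])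

lemma mul_mem_unitaryMaps {U V : InvMap d} (hU : U ∈ unitaryMaps d) (hV : V ∈ unitaryMaps d) :
    U * V ∈ unitaryMaps d := by
  obtain ⟨u, rfl⟩ := hU
  obtain ⟨v, rfl⟩ := hV
  exact ⟨u * v, (ofUnitary_mul u v).symm⟩

lemma inv_mem_unitaryMaps {U : InvMap d} (hU : U ∈ unitaryMaps d) : U⁻¹ ∈ unitaryMaps d := by
  obtain ⟨u, rfl⟩ := hU
  exact ⟨u⁻¹, (ofUnitary_inv u).symm⟩

lemma transposeMap_inv : (transposeMap d)⁻¹ = transposeMap d :=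
  inv_eq_of_mul_eq_one_left (LinearEquiv.ext fun X => transpose_transpose X)

lemma transposeMap_conj_mem_unitaryMaps {U : InvMap d} (hU : U ∈ unitaryMaps d) :
    transposeMap d * U * transposeMap d ∈ unitaryMaps d := by
  obtain ⟨u, rfl⟩ := hU
  have hu : (u : Matrix (Fin d) (Fin d) ℂ)ᴴ * (u : Matrix (Fin d) (Fin d) ℂ) = 1 :=
    UnitaryGroup.star_mul_self u
  have hT : ((u : Matrix (Fin d) (Fin d) ℂ)ᴴᵀ)ᴴ = (u : Matrix (Fin d) (Fin d) ℂ)ᵀ := by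
    ext i j
    simp
  have h : ((u : Matrix (Fin d) (Fin d) ℂ)ᴴᵀ) ∈ unitaryGroup (Fin d) ℂ := by
    rw [mem_unitaryGroup_iff, star_eq_conjTranspose, hT, ← transpose_mul, mul_eq_one_comm.1 hu, transpose_one]
  refine ⟨⟨_, h⟩, LinearEquiv.ext fun X => ?_⟩
  change ((u : Matrix (Fin d) (Fin d) ℂ) * Xᵀ * (u : Matrix (Fin d) (Fin d) ℂ)ᴴ)ᵀ =
    (u : Matrix (Fin d) (Fin d) ℂ)ᴴᵀ * X * ((u : Matrix (Fin d) (Fin d) ℂ)ᴴᵀ)ᴴ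
  rw [transpose_mul, transpose_mul, transpose_transpose, hT, Matrix.mul_assoc]

lemma inv_mem_symmetryMaps {S : InvMap d} (hS : S ∈ symmetryMaps d) : S⁻¹ ∈ symmetryMaps d := by
  rcases hS with hS | ⟨U, hU, rfl⟩
  · exact Or.inl (inv_mem_unitaryMaps hS)
  · refine Or.inr ⟨_, transposeMap_conj_mem_unitaryMaps (inv_mem_unitaryMaps hU), ?_⟩
    rw [_root_.mul_inv_rev, transposeMap_inv, ← mul_assoc, ← mul_assoc]
    conv_rhs => enter [1, 1, 1]; rw [← transposeMap_inv]
    rw [inv_mul_cancel, one_mul]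

lemma symmetryMaps_conj_mem_unitaryMaps {S U : InvMap d} (hS : S ∈ symmetryMaps d)
    (hU : U ∈ unitaryMaps d) : S⁻¹ * U * S ∈ unitaryMaps d := by
  rcases hS with hS | ⟨V, hV, rfl⟩
  · exact mul_mem_unitaryMaps (mul_mem_unitaryMaps (inv_mem_unitaryMaps hS) hU) hS
  · have h := mul_mem_unitaryMaps (mul_mem_unitaryMaps (inv_mem_unitaryMaps hV)
      (transposeMap_conj_mem_unitaryMaps hU)) hV
    rw [_root_.mul_inv_rev, transposeMap_inv]
    simpa only [mul_assoc] using h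

lemma mem_symmetryMaps_of_map_mul_or {θ : InvMap d}
    (hmul : (∀ A B, θ (A * B) = θ A * θ B) ∨ (∀ A B, θ (A * B) = θ B * θ A))
    (hstar : ∀ A, θ Aᴴ = (θ A)ᴴ) : θ ∈ symmetryMaps d := by
  rcases hmul with h | h
  · exact Or.inl (exists_unitary_of_map_mul h hstar)
  · have hU : transposeMap d * θ ∈ unitaryMaps d := by
      refine exists_unitary_of_map_mul (fun A B => ?_) (fun A => ?_)
      · change (θ (A * B))ᵀ = (θ A)ᵀ * (θ B)ᵀ
        rw [h, transpose_mul]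
      · change (θ Aᴴ)ᵀ = ((θ A)ᵀ)ᴴ
        rw [hstar]
        rfl
    refine Or.inr ⟨_, hU, ?_⟩
    rw [← mul_assoc]
    conv_rhs => enter [1, 1]; rw [← transposeMap_inv]
    rw [inv_mul_cancel, one_mul]

lemma ofUnitary_eq_one_of_le_one (hd : d ≤ 1) (u : unitaryGroup (Fin d) ℂ) : ofUnitary u = 1 := by
  have : Subsingleton (Fin d) := Fin.subsingleton_iff_le_one.2 hd
  have hu : (u : Matrix (Fin d) (Fin d) ℂ) * (u : Matrix (Fin d) (Fin d) ℂ)ᴴ = 1 :=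
    Unitary.coe_mul_star_self u
  refine LinearEquiv.ext fun X => ?_
  change (u : Matrix (Fin d) (Fin d) ℂ) * X * (u : Matrix (Fin d) (Fin d) ℂ)ᴴ = X
  have hcomm : (u : Matrix (Fin d) (Fin d) ℂ) * X = X * u := by
    ext i j
    simp only [mul_apply, Fintype.sum_subsingleton _ i, Subsingleton.elim j i, mul_comm]
  rw [hcomm, Matrix.mul_assoc, hu, mul_one]

lemma exists_symmetryMap_conj_eq {T : InvMap d}
    (h : ∀ U ∈ unitaryMaps d, T⁻¹ * U * T ∈ unitaryMaps d) :
    ∃ S ∈ symmetryMaps d, ∀ U ∈ unitaryMaps d, S⁻¹ * U * S = T⁻¹ * U * T := by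
  rcases Nat.lt_or_ge d 2 with hd | hd
  -- For d ≤ 1 every unitary map is the identity.
  · refine ⟨1, Or.inl ⟨1, ofUnitary_one.symm⟩, ?_⟩
    rintro _ ⟨u, rfl⟩
    simp [ofUnitary_eq_one_of_le_one (Nat.le_of_lt_succ hd)]
  have hφ' : ∀ u w : unitaryGroup (Fin d) ℂ, T⁻¹ * ofUnitary u * T = ofUnitary w →
      conjEnd u = T.conjAlgEquiv ℂ (conjEnd w) := by
    intro u w huw
    ext1 X
    change ofUnitary u X = T (ofUnitary w (T⁻¹ X))
    rw [← huw]
    change ofUnitary u X = (T * (T⁻¹ * ofUnitary u * T) * T⁻¹) X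
    congr 1
    group
  have hφ : ∀ u : unitaryGroup (Fin d) ℂ, ∃ w : unitaryGroup (Fin d) ℂ,
      conjEnd u = T.conjAlgEquiv ℂ (conjEnd w) := fun u =>
    (h _ ⟨u, rfl⟩).imp fun w hw => hφ' u w hw
  obtain ⟨s, hs, hsv⟩ := exists_sign_adOuterEq hd hφ
  have hss : s * s = 1 := by rcases hs with rfl | rfl <;> norm_num
  obtain ⟨θ, had, htr, hproj⟩ := exists_linearEquiv_ad_eq hss hsv
  refine ⟨θ⁻¹, inv_mem_symmetryMaps (mem_symmetryMaps_of_map_mul_or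
    (map_mul_or_map_mul_reverse (by omega) hss had htr hproj hs)
    (map_conjTranspose_of_isStarProjection_outer hproj)), ?_⟩
  rintro _ ⟨u, rfl⟩
  obtain ⟨w, hw⟩ := h _ ⟨u, rfl⟩
  rw [hw, inv_inv, mul_inv_eq_iff_eq_mul]
  exact LinearEquiv.ext fun X => map_conjEnd_of_ad_eq hss had htr (hφ' u w hw) X

end MatrixMap

theorem lemma2 (d : ℕ) (T : MatrixMap.InvMap d) :
    (∀ U ∈ MatrixMap.unitaryMaps d, T⁻¹ * U * T ∈ MatrixMap.unitaryMaps d) ↔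
      ∃ S ∈ MatrixMap.symmetryMaps d,
        ∀ U ∈ MatrixMap.unitaryMaps d, S⁻¹ * U * S = T⁻¹ * U * T := by
  constructor
  · exact MatrixMap.exists_symmetryMap_conj_eq
  · rintro ⟨S, hS, h⟩ U hU
    rw [← h U hU]
    exact MatrixMap.symmetryMaps_conj_mem_unitaryMaps hS hU
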